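/- Let $K$ be a field and $V$ a $K$-vector space of finite dimension $n$. Let $T(V)$ be the simplicial complex whose vertices are the subspaces $W\subset V$ with $0\neq W\neq V$ and whose simplices are the flags of such subspaces. Define the reduced Steinberg module $\widetilde{\operatorname{St}}(V)$ to be $H_{n-2}(T(V),\mathbf Z)$ if $n>2$, the kernel of the augmentation $H_0(T(V),\mathbf Z)\to\mathbf Z$ (sending the class of every line to $1$) if $n=2$, and $\mathbf Z$ if $n\le 1$. For a sequence $Q=(v_0,\dots,v_{n-1})$ of nonzero vectors of $V$ define the universal modular symbol $[v_0,\dots,v_{n-1}]\in\widetilde{\operatorname{St}}(V)$ as follows. If $n\ge 2$, let $\partial$ be the simplicial complex whose vertices are the nonempty proper subsets of $\{0,\dots,n-1\}$ and whose simplices are the flags of such subsets, and let $\zeta\in H_{n-2}(\partial,\mathbf Z)$ be the fundamental class, i.e. the class of $$(-1)^{n-1}\sum_{\sigma\in\mathfrak S_n}\operatorname{sgn}(\sigma)\,\bigl(\{\sigma(0)\},\{\sigma(0),\sigma(1)\},\dots,\{\sigma(0),\dots,\sigma(n-2)\}\bigr)$$ (for $n=2$ this is $[\{1\}]-[\{0\}]$).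 Then $[v_0,\dots,v_{n-1}]=(\phi_Q)_*\zeta$, where $\phi_Q:\partial\to T(V)$ is the simplicial map $I\mapsto\langle v_i\rangle_{i\in I}$. If $n\le 1$, every symbol is $1\in\mathbf Z$. Then the abelian group $\widetilde{\operatorname{St}}(V)$ is presented by the generators $[v_0,\dots,v_{n-1}]$, where $(v_0,\dots,v_{n-1})$ runs over all sequences of $n$ nonzero vectors of $V$, and the following relations: (a) transposition of two vectors changes the sign of the symbol; (b) $[a v_0,v_1,\dots,v_{n-1}]=[v_0,v_1,\dots,v_{n-1}]$ for $a\in K\setminus\{0\}$ (when $n\ge1$); (c) $[v_0,\dots,v_{n-1}]=0$ if $\det(v_0,\dots,v_{n-1})=0$; (d) $\sum_{i=0}^n(-1)^i[v_0,\dots,\widehat{v_i},\dots,v_n]=0$ for all nonzero $v_0,\dots,v_n\in V$. That is, the homomorphism from the free abelian group on the sequences $(v_0,\dots,v_{n-1})$ of nonzero vectors to $\widetilde{\operatorname{St}}(V)$ sending $(v_0,\dots,v_{n-1})$ to its universal modular symbol is surjective, and its kernel is generated by the relations (a)-(d). -/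

import Mathlib

universe u v

noncomputable section

/-! ### Homology of abstract simplicial complexes (ordered chains) -/

namespace AbstractSimplicialComplex

variable {ι : Type u} {κ : Type v}

/-- Ordered `p`-simplices: `(p+1)`-tuples of vertices, repetitions allowed, whose set of entries
is a simplex of `X`. -/
def OrderedSimplex (X : AbstractSimplicialComplex ι) (p : ℕ) : Type u :=
  {x : Fin (p + 1) → ι // ∃ s ∈ X, (s : Set ι) = Set.range x}

/-- The face of an ordered simplex obtained by omitting the `i`-th vertex. -/
def OrderedSimplex.face {X : AbstractSimplicialComplex ι} {p : ℕ}
    (x : X.OrderedSimplex (p + 1)) (i : Fin (p + 2)) : X.OrderedSimplex p :=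
  ⟨x.1 ∘ i.succAbove, by
    classical
    obtain ⟨s, hs, h⟩ := x.2
    refine ⟨Finset.univ.image (x.1 ∘ i.succAbove), (X.isRelLowerSet_faces hs).2 ?_ ?_,
      by rw [Finset.coe_image, Finset.coe_univ, Set.image_univ]⟩
    · show Finset.univ.image (x.1 ∘ i.succAbove) ⊆ s
      rw [← Finset.coe_subset, h, Finset.coe_image, Finset.coe_univ, Set.image_univ]
      exact Set.range_comp_subset_range i.succAbove x.1
    · exact Finset.univ_nonempty.image _⟩

/-- The group of ordered `p`-chains. -/
abbrev Chains (X : AbstractSimplicialComplex ι) (p : ℕ) : Type u :=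
  X.OrderedSimplex p →₀ ℤ

/-- The boundary `(x₀, …, x_{p+1}) ↦ ∑ᵢ (-1)ⁱ (x₀, …, x̂ᵢ, …, x_{p+1})`. -/
def boundary (X : AbstractSimplicialComplex ι) (p : ℕ) : X.Chains (p + 1) →ₗ[ℤ] X.Chains p :=
  Finsupp.linearCombination ℤ
    fun x => ∑ i : Fin (p + 2), (-1 : ℤ) ^ (i : ℕ) • Finsupp.single (x.face i) 1

/-- The group of `p`-cycles. -/
def cycles (X : AbstractSimplicialComplex ι) : (p : ℕ) → Submodule ℤ (X.Chains p)
  | 0 => ⊤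
  | p + 1 => LinearMap.ker (X.boundary p)

/-- The boundaries, as a subgroup of the group of cycles. -/
def boundaries (X : AbstractSimplicialComplex ι) (p : ℕ) : Submodule ℤ (X.cycles p) :=
  (LinearMap.range (X.boundary p)).comap (X.cycles p).subtype

/-- The `p`-th simplicial homology group with integral coefficients. -/
abbrev Homology (X : AbstractSimplicialComplex ι) (p : ℕ) : Type u :=
  X.cycles p ⧸ X.boundaries p

/-- The augmentation of `0`-chains, sending each vertex to `1`. -/
def chainAugmentation (X : AbstractSimplicialComplex ι) : X.Chains 0 →ₗ[ℤ] ℤ :=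
  Finsupp.linearCombination ℤ fun _ => (1 : ℤ)

theorem chainAugmentation_boundary (X : AbstractSimplicialComplex ι) (c : X.Chains 1) :
    X.chainAugmentation (X.boundary 0 c) = 0 := by
  have : X.chainAugmentation ∘ₗ X.boundary 0 = 0 := by
    ext x
    simp [chainAugmentation, boundary, Fin.sum_univ_two]
  exact LinearMap.congr_fun this c

/-- The augmentation `H₀(X) → ℤ`, sending the class of each vertex to `1`. -/
def augmentation (X : AbstractSimplicialComplex ι) : X.Homology 0 →ₗ[ℤ] ℤ :=
  (X.boundaries 0).liftQ (X.chainAugmentation ∘ₗ (X.cycles 0).subtype) (by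
    rintro c ⟨b, hb⟩
    have h := X.chainAugmentation_boundary b
    rw [hb] at h
    exact h)

/-- A simplicial map: a map of vertices sending simplices to simplices. -/
structure SimplicialMap (X : AbstractSimplicialComplex ι) (Y : AbstractSimplicialComplex κ) where
  /-- the map on vertices -/
  toFun : ι → κ
  /-- simplices are sent to simplices -/
  map_simplex : ∀ s ∈ X, ∃ t ∈ Y, (t : Set κ) = toFun '' s

variable {X : AbstractSimplicialComplex ι} {Y : AbstractSimplicialComplex κ}

/-- The image of an ordered simplex under a simplicial map. -/
def SimplicialMap.mapSimplex (f : SimplicialMap X Y) {p : ℕ} (x : X.OrderedSimplex p) :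
    Y.OrderedSimplex p :=
  ⟨f.toFun ∘ x.1, by
    obtain ⟨s, hs, h⟩ := x.2
    obtain ⟨t, ht, h'⟩ := f.map_simplex s hs
    exact ⟨t, ht, by rw [h', h, Set.range_comp]⟩⟩

/-- The map induced on ordered chains. -/
def SimplicialMap.mapChains (f : SimplicialMap X Y) (p : ℕ) : X.Chains p →ₗ[ℤ] Y.Chains p :=
  Finsupp.lmapDomain ℤ ℤ f.mapSimplex

theorem SimplicialMap.mapChains_boundary (f : SimplicialMap X Y) (p : ℕ) (c : X.Chains (p + 1)) :
    f.mapChains p (X.boundary p c) = Y.boundary p (f.mapChains (p + 1) c) := by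
  have : f.mapChains p ∘ₗ X.boundary p = Y.boundary p ∘ₗ f.mapChains (p + 1) := by
    ext1 x
    ext1
    simp only [mapChains, boundary, LinearMap.comp_apply, Finsupp.lsingle_apply,
      Finsupp.linearCombination_single, one_smul, map_sum, map_smul, Finsupp.lmapDomain_apply,
      Finsupp.mapDomain_single]
    rfl
  exact LinearMap.congr_fun this c

theorem SimplicialMap.mapChains_mem_cycles (f : SimplicialMap X Y) :
    ∀ (p : ℕ) (c : X.Chains p), c ∈ X.cycles p → f.mapChains p c ∈ Y.cycles p
  | 0, _, _ => trivial
  | p + 1, c, hc => by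
    have hc' : X.boundary p c = 0 := hc
    show Y.boundary p (f.mapChains (p + 1) c) = 0
    rw [← f.mapChains_boundary, hc', map_zero]

/-- The map induced on homology. -/
def SimplicialMap.mapHomology (f : SimplicialMap X Y) (p : ℕ) : X.Homology p →ₗ[ℤ] Y.Homology p :=
  (X.boundaries p).mapQ (Y.boundaries p)
    ((f.mapChains p).restrict (f.mapChains_mem_cycles p)) (by
      rintro c ⟨b, hb⟩
      refine ⟨f.mapChains (p + 1) b, ?_⟩
      rw [← f.mapChains_boundary, hb]
      rfl)

theorem SimplicialMap.augmentation_mapHomology (f : SimplicialMap X Y) (h : X.Homology 0) :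
    Y.augmentation (f.mapHomology 0 h) = X.augmentation h := by
  have key : Y.chainAugmentation ∘ₗ f.mapChains 0 = X.chainAugmentation := by
    ext x
    simp [chainAugmentation, mapChains]
  obtain ⟨c, rfl⟩ := Submodule.mkQ_surjective _ h
  exact LinearMap.congr_fun key c.1

/-- The simplicial complex of nonempty finite totally ordered subsets (flags) of a poset. -/
def flagComplex (P : Type u) [PartialOrder P] : AbstractSimplicialComplex P where
  faces := {s | s.Nonempty ∧ IsChain (· ≤ ·) (s : Set P)}
  isRelLowerSet_faces := fun _ hs =>
    ⟨hs.1, fun _ hts ht => ⟨ht, hs.2.mono (Finset.coe_subset.2 hts)⟩⟩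
  singleton_mem := fun a => ⟨Finset.singleton_nonempty a, by simp⟩

/-- The simplicial map of flag complexes induced by a monotone map. -/
def flagComplexMap {P : Type u} {Q : Type v} [PartialOrder P] [PartialOrder Q] (f : P →o Q) :
    SimplicialMap (flagComplex P) (flagComplex Q) where
  toFun := f
  map_simplex := fun s hs => by
    classical
    exact ⟨s.image f, ⟨hs.1.image f, by
      rw [Finset.coe_image]
      rintro _ ⟨a, ha, rfl⟩ _ ⟨b, hb, rfl⟩ _
      exact (hs.2.total ha hb).imp (fun h => f.monotone h) (fun h => f.monotone h)⟩,
      Finset.coe_image⟩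

end AbstractSimplicialComplex

open AbstractSimplicialComplex

/-! ### The fundamental class of the subdivided boundary of a simplex -/

/-- Nonempty proper subsets of `{0, …, n-1}`: the proper faces of the simplex with `n` vertices. -/
abbrev ProperFace (n : ℕ) : Type := {I : Finset (Fin n) // I.Nonempty ∧ I ≠ Finset.univ}

/-- The boundary of the barycentric subdivision of the simplex with vertices `0, …, n-1`. -/
abbrev boundarySd (n : ℕ) : AbstractSimplicialComplex (ProperFace n) := flagComplex (ProperFace n)

/-- The proper face `{σ 0, …, σ k}`. -/
def permFace {m : ℕ} (σ : Equiv.Perm (Fin (m + 2))) (k : Fin (m + 1)) : ProperFace (m + 2) :=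
  ⟨(Finset.Iic k.castSucc).map σ.toEmbedding, by simp, fun h => by
    have h1 : σ (Fin.last _) ∈ (Finset.Iic k.castSucc).map σ.toEmbedding := by
      rw [h]; exact Finset.mem_univ _
    simp at h1⟩

theorem permFace_mono {m : ℕ} (σ : Equiv.Perm (Fin (m + 2))) : Monotone (permFace σ) :=
  fun _ _ h => Finset.map_subset_map.2 (Finset.Iic_subset_Iic.2 (Fin.castSucc_le_castSucc_iff.2 h))

/-- The maximal flag `{σ 0} ⊂ {σ 0, σ 1} ⊂ ⋯ ⊂ {σ 0, …, σ (n-2)}`, where `n = m + 2`. -/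
def permFlag {m : ℕ} (σ : Equiv.Perm (Fin (m + 2))) : (boundarySd (m + 2)).OrderedSimplex m :=
  ⟨permFace σ, by
    classical
    refine ⟨Finset.univ.image (permFace σ), ⟨Finset.univ_nonempty.image _, ?_⟩, by simp⟩
    rw [Finset.coe_image, Finset.coe_univ, Set.image_univ]
    exact (permFace_mono σ).isChain_range⟩

/-- The fundamental cycle of the subdivided boundary of the oriented simplex `(0, …, n-1)`,
`n = m + 2`: the boundary part of the fundamental chain
`∑_σ sgn(σ) ({σ 0}, {σ 0, σ 1}, …, {σ 0, …, σ (n-1)})` of the subdivided simplex. The last face of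
each of these `(n-1)`-simplices has sign `(-1)^(n-1)`. For `n = 2` this is `[1] - [0]`. -/
def fundamentalChain (m : ℕ) : (boundarySd (m + 2)).Chains m :=
  (-1 : ℤ) ^ (m + 1) •
    ∑ σ : Equiv.Perm (Fin (m + 2)), (Equiv.Perm.sign σ : ℤ) • Finsupp.single (permFlag σ) 1

theorem permFlag_face_swap {m : ℕ} (σ : Equiv.Perm (Fin (m + 3))) (i : Fin (m + 2)) :
    (permFlag (σ * Equiv.swap i.castSucc i.succ)).face i = (permFlag σ).face i := by
  apply Subtype.ext
  funext j
  apply Subtype.ext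
  have hne : i.succAbove j ≠ i := Fin.succAbove_ne i j
  show (Finset.Iic (i.succAbove j).castSucc).map (σ * Equiv.swap i.castSucc i.succ).toEmbedding =
    (Finset.Iic (i.succAbove j).castSucc).map σ.toEmbedding
  generalize i.succAbove j = k at hne
  have h1 : (σ * Equiv.swap i.castSucc i.succ).toEmbedding =
      (Equiv.swap i.castSucc i.succ).toEmbedding.trans σ.toEmbedding := rfl
  rw [h1, ← Finset.map_map]
  congr 1
  ext x
  rw [Finset.mem_map_equiv, Equiv.symm_swap, Finset.mem_Iic, Finset.mem_Iic, Equiv.swap_apply_def]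
  have hne' : (k : ℕ) ≠ i := fun h => hne (Fin.ext h)
  split_ifs with ha hb
  · subst ha
    simp only [Fin.le_def, Fin.val_succ, Fin.val_castSucc]
    omega
  · subst hb
    simp only [Fin.le_def, Fin.val_succ, Fin.val_castSucc]
    omega
  · rfl

theorem fundamentalChain_mem_cycles : ∀ m : ℕ,
    fundamentalChain m ∈ (boundarySd (m + 2)).cycles m
  | 0 => trivial
  | m + 1 => by
    show (boundarySd (m + 3)).boundary m (fundamentalChain (m + 1)) = 0
    simp only [fundamentalChain, boundary, map_smul, map_sum, Finsupp.linearCombination_single,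
      one_smul, Finset.smul_sum]
    rw [Finset.sum_comm]
    refine Finset.sum_eq_zero fun i _ => ?_
    rw [← Finset.smul_sum]
    refine smul_eq_zero_of_right _ ?_
    refine Finset.sum_involution (fun σ _ => σ * Equiv.swap i.castSucc i.succ) ?_ ?_
      (fun _ _ => Finset.mem_univ _) (fun σ _ => by simp [mul_assoc])
    · intro σ _
      rw [permFlag_face_swap, Equiv.Perm.sign_mul, Equiv.Perm.sign_swap (by simp [Fin.ext_iff])]
      simp
    · intro σ _ _ h
      have h2 : Equiv.swap i.castSucc i.succ = 1 := by simpa using h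
      rw [Equiv.Perm.one_def, Equiv.swap_eq_refl_iff] at h2
      simp [Fin.ext_iff] at h2

/-- The fundamental class `ζ` in degree `n - 2`, for `n = m + 2`. -/
def fundamentalClass (m : ℕ) : (boundarySd (m + 2)).Homology m :=
  ((boundarySd (m + 2)).boundaries m).mkQ ⟨fundamentalChain m, fundamentalChain_mem_cycles m⟩

theorem augmentation_fundamentalClass :
    (boundarySd 2).augmentation (fundamentalClass 0) = 0 := by
  show (boundarySd 2).chainAugmentation (fundamentalChain 0) = 0
  simp only [fundamentalChain, chainAugmentation, map_smul, map_sum,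
    Finsupp.linearCombination_single]
  decide

/-! ### The Tits building and the Steinberg module -/

section Steinberg

variable (K : Type u) (V : Type v) [Field K] [AddCommGroup V] [Module K V]

/-- Nonzero proper subspaces of `V`. -/
abbrev ProperSubspace : Type v := {W : Submodule K V // W ≠ ⊥ ∧ W ≠ ⊤}

/-- The Tits building of `V`: the simplicial complex of flags of nonzero proper subspaces. -/
abbrev titsBuilding : AbstractSimplicialComplex (ProperSubspace K V) :=
  flagComplex (ProperSubspace K V)

/-- The reduced Steinberg module of a vector space `V` of dimension `n`. -/
def ReducedSteinberg : ℕ → Type v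
  | 0 => ULift.{v} ℤ
  | 1 => ULift.{v} ℤ
  | 2 => LinearMap.ker (titsBuilding K V).augmentation
  | m + 3 => (titsBuilding K V).Homology (m + 1)

instance : (n : ℕ) → AddCommGroup (ReducedSteinberg K V n)
  | 0 => inferInstanceAs (AddCommGroup (ULift.{v} ℤ))
  | 1 => inferInstanceAs (AddCommGroup (ULift.{v} ℤ))
  | 2 => inferInstanceAs (AddCommGroup (LinearMap.ker (titsBuilding K V).augmentation))
  | m + 3 => inferInstanceAs (AddCommGroup ((titsBuilding K V).Homology (m + 1)))

variable {K V}

/-- The span of `vᵢ`, `i ∈ I`, for a proper face `I`. -/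
def spanFace {n : ℕ} (hn : Module.finrank K V = n) (Q : Fin n → {v : V // v ≠ 0})
    (I : ProperFace n) : ProperSubspace K V :=
  ⟨Submodule.span K ((fun i => (Q i : V)) '' (I.1 : Set (Fin n))), by
    obtain ⟨i, hi⟩ := I.2.1
    intro h
    refine (Q i).2 ((Submodule.mem_bot K).1 ?_)
    rw [← h]
    exact Submodule.subset_span ⟨i, hi, rfl⟩, by
    classical
    intro h
    have h1 := finrank_span_finset_le_card (R := K) (I.1.image fun i => (Q i : V))
    rw [Set.finrank, Finset.coe_image, h, finrank_top, hn] at h1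
    have h2 : I.1.card < n := by
      simpa using Finset.card_lt_card (Finset.ssubset_univ_iff.2 I.2.2)
    have h3 := Finset.card_image_le (s := I.1) (f := fun i => (Q i : V))
    omega⟩

/-- The simplicial map `φ_Q` sending the vertex `I` to the span of `vᵢ`, `i ∈ I`. -/
def phi {n : ℕ} (hn : Module.finrank K V = n) (Q : Fin n → {v : V // v ≠ 0}) :
    SimplicialMap (boundarySd n) (titsBuilding K V) :=
  flagComplexMap ⟨spanFace hn Q, fun _ _ h => Submodule.span_mono (Set.image_mono h)⟩

/-- The class `(φ_Q)_* ζ` in degree `n - 2` of the homology of the Tits building, `n = m + 2`. -/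
def symbolClass {m : ℕ} (hn : Module.finrank K V = m + 2) (Q : Fin (m + 2) → {v : V // v ≠ 0}) :
    (titsBuilding K V).Homology m :=
  (phi hn Q).mapHomology m (fundamentalClass m)

/-- The universal modular symbol `[v₀, …, v_{n-1}]` of a sequence of `n = dim V` nonzero vectors.
For `n ≤ 1` it is the generator `1` of `ℤ`. -/
def universalModularSymbol : (n : ℕ) → Module.finrank K V = n → (Fin n → {v : V // v ≠ 0}) →
    ReducedSteinberg K V n
  | 0, _, _ => ULift.up (1 : ℤ)
  | 1, _, _ => ULift.up (1 : ℤ)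
  | 2, hn, Q => (⟨symbolClass hn Q, by
      rw [LinearMap.mem_ker]
      exact ((phi hn Q).augmentation_mapHomology _).trans augmentation_fundamentalClass⟩ :
      LinearMap.ker (titsBuilding K V).augmentation)
  | _ + 3, hn, Q => symbolClass hn Q

/-! ### The Ash-Rudolph relations -/

variable (K V)

/-- The relations (a)-(d) between the symbols `[v₀, …, v_{n-1}]`, as elements of the free abelian
group on the sequences of `n` nonzero vectors of `V`. -/
inductive AshRudolphRelation (n : ℕ) : FreeAbelianGroup (Fin n → {v : V // v ≠ 0}) → Prop
  /-- (a) A transposition of two vectors changes the sign. -/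
  | antisymmetry (Q : Fin n → {v : V // v ≠ 0}) (i j : Fin n) (hij : i ≠ j) :
      AshRudolphRelation n (.of (Q ∘ Equiv.swap i j) + .of Q)
  /-- (b) `[a v₀, v₁, …, v_{n-1}] = [v₀, v₁, …, v_{n-1}]` for nonzero scalars `a`. -/
  | homogeneity (Q Q' : Fin n → {v : V // v ≠ 0}) (a : K) (ha : a ≠ 0)
      (h : ∀ i, (Q' i : V) = if (i : ℕ) = 0 then a • (Q i : V) else Q i) :
      AshRudolphRelation n (.of Q' - .of Q)
  /-- (c) `[Q] = 0` if `det Q = 0`. -/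
  | det (Q : Fin n → {v : V // v ≠ 0}) (b : Module.Basis (Fin n) K V)
      (h : b.det (fun i => (Q i : V)) = 0) :
      AshRudolphRelation n (.of Q)
  /-- (d) The cocycle relation `∑ᵢ (-1)ⁱ [v₀, …, v̂ᵢ, …, vₙ] = 0`. -/
  | cocycle (P : Fin (n + 1) → {v : V // v ≠ 0}) :
      AshRudolphRelation n
        (∑ i : Fin (n + 1), (-1 : ℤ) ^ (i : ℕ) • FreeAbelianGroup.of (P ∘ i.succAbove))

/-- The subgroup generated by the relations (a)-(d). -/
def ashRudolphSubgroup (n : ℕ) : AddSubgroup (FreeAbelianGroup (Fin n → {v : V // v ≠ 0})) :=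
  AddSubgroup.closure {r | AshRudolphRelation K V n r}

end Steinberg

end

/-!
Let `C` be the augmented complex of all tuples of nonzero vectors of `V`, indexed by the number of
entries, and let `D` be the subcomplex of the tuples whose span is a proper subspace. Coning off
with a fixed vector shows that `C` is acyclic. A tuple with fewer than `n = dim V` entries lies in
`D`, so the group presented by the sequences of `n` nonzero vectors with the determinant and the
cocycle relations is `H_n(C / D)`, which the boundary map identifies with `H_{n-1}(D)`. The Steinberg module is the
same homology group of the complex of flags of proper subspaces, and the two complexes are chain
homotopy equivalent:

* from `D` to flags, `TupleChain.subdivision` sends a tuple to its barycentric subdivision, each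
  face being replaced by its span;
* from flags to `D`, one applies a choice of a nonzero vector in each nonzero subspace
  (`TupleChain.chosenVector`).

The two composites are homotopic to the identity because they preserve carriers that are cones: the
tuples of vectors of the span of a given tuple (`TupleChain.exists_homotopy_vectors`), and the flags
below the largest member of a given flag (`TupleChain.exists_homotopy_flags`). The universal modular
symbol of `Q` is the subdivision of the boundary of `Q` (`flagEmb_symbolCycle`), as one sees by
sorting the permutations by their last value. Hence the comparison takes the symbols to the
generators, and both surjectivity and the determination of the kernel are short computations with
the homotopies. Antisymmetry and homogeneity of the symbols are clear from the formula, and these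
relations are not needed to generate the kernel. In dimension at most `1` everything is checked directly.
-/

/-! ### Augmented chains of tuples -/

/-- The free abelian group on the `p`-tuples of elements of `α`: the augmented ordered chains of
the full simplex on `α`. The index `p` counts vertices, so that degree `p` here is simplicial
degree `p - 1`, and `p = 0` is the target of the augmentation. -/
abbrev TupleChain (α : Type*) (p : ℕ) := (Fin p → α) →₀ ℤ

namespace TupleChain

variable {α β : Type*} {p : ℕ}

/-- The augmented boundary `(x₀, …, x_p) ↦ ∑ᵢ (-1)ⁱ (x₀, …, x̂ᵢ, …, x_p)`. -/
noncomputable def bd (p : ℕ) : TupleChain α (p + 1) →ₗ[ℤ] TupleChain α p :=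
  Finsupp.linearCombination ℤ
    fun x => ∑ i : Fin (p + 1), (-1 : ℤ) ^ (i : ℕ) • Finsupp.single (x ∘ i.succAbove) 1

theorem bd_single (x : Fin (p + 1) → α) :
    bd p (Finsupp.single x 1) =
      ∑ i : Fin (p + 1), (-1 : ℤ) ^ (i : ℕ) • Finsupp.single (x ∘ i.succAbove) 1 := by
  simp [bd]

/-- The map induced on tuple chains by a map of vertices. -/
noncomputable def map (g : α → β) (p : ℕ) : TupleChain α p →ₗ[ℤ] TupleChain β p :=
  Finsupp.lmapDomain ℤ ℤ (g ∘ ·)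

theorem map_single (g : α → β) (x : Fin p → α) :
    map g p (Finsupp.single x 1) = Finsupp.single (g ∘ x) 1 := by
  simp [map, Finsupp.mapDomain_single]

theorem bd_map (g : α → β) (c : TupleChain α (p + 1)) :
    bd p (map g (p + 1) c) = map g p (bd p c) := by
  have : bd p ∘ₗ map g (p + 1) = map g p ∘ₗ bd p := by
    ext1 x
    ext1
    simp only [LinearMap.comp_apply, Finsupp.lsingle_apply, map_single, bd_single, map_sum,
      map_smul]
    rfl
  exact LinearMap.congr_fun this c

/-- Adding the vertex `a` in front of every tuple. -/
noncomputable def coneFront (a : α) (p : ℕ) : TupleChain α p →ₗ[ℤ] TupleChain α (p + 1) :=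
  Finsupp.lmapDomain ℤ ℤ fun x => Fin.cons a x

theorem coneFront_single (a : α) (x : Fin p → α) :
    coneFront a p (Finsupp.single x 1) = Finsupp.single (Fin.cons a x) 1 := by
  simp [coneFront, Finsupp.mapDomain_single]

/-- Adding the vertex `a` at the end of every tuple. -/
noncomputable def coneBack (a : α) (p : ℕ) : TupleChain α p →ₗ[ℤ] TupleChain α (p + 1) :=
  Finsupp.lmapDomain ℤ ℤ fun x => Fin.snoc x a

theorem coneBack_single (a : α) (x : Fin p → α) :
    coneBack a p (Finsupp.single x 1) = Finsupp.single (Fin.snoc x a) 1 := by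
  simp [coneBack, Finsupp.mapDomain_single]

theorem bd_coneFront_zero (a : α) (c : TupleChain α 0) : bd 0 (coneFront a 0 c) = c := by
  have : bd 0 ∘ₗ coneFront a 0 = LinearMap.id := by
    ext1 x
    ext1
    simp only [LinearMap.comp_apply, Finsupp.lsingle_apply, coneFront_single, bd_single,
      LinearMap.id_apply]
    simp [Subsingleton.elim _ x]
  exact LinearMap.congr_fun this c

theorem bd_coneFront (a : α) (c : TupleChain α (p + 1)) :
    bd (p + 1) (coneFront a (p + 1) c) = c - coneFront a p (bd p c) := by
  have : bd (p + 1) ∘ₗ coneFront a (p + 1) = LinearMap.id - coneFront a p ∘ₗ bd p := by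
    ext1 x
    ext1
    simp only [LinearMap.comp_apply, LinearMap.sub_apply, Finsupp.lsingle_apply, coneFront_single,
      bd_single, LinearMap.id_apply, map_sum, map_smul]
    rw [Fin.sum_univ_succ, sub_eq_add_neg, ← Finset.sum_neg_distrib]
    congr 1
    · simp only [Fin.val_zero, pow_zero, one_smul]
      congr 1
    · refine Finset.sum_congr rfl fun i _ => ?_
      rw [Fin.val_succ, pow_succ, mul_neg_one, neg_smul]
      congr 3
      funext j
      refine Fin.cases ?_ (fun j => ?_) j <;> simp
  exact LinearMap.congr_fun this c

theorem bd_coneBack_zero (a : α) (c : TupleChain α 0) : bd 0 (coneBack a 0 c) = c := by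
  have : bd 0 ∘ₗ coneBack a 0 = LinearMap.id := by
    ext1 x
    ext1
    simp only [LinearMap.comp_apply, Finsupp.lsingle_apply, coneBack_single, bd_single,
      LinearMap.id_apply]
    simp [Subsingleton.elim _ x]
  exact LinearMap.congr_fun this c

theorem bd_coneBack (a : α) (c : TupleChain α (p + 1)) :
    bd (p + 1) (coneBack a (p + 1) c) = coneBack a p (bd p c) + (-1 : ℤ) ^ (p + 1) • c := by
  have : bd (p + 1) ∘ₗ coneBack a (p + 1) =
      coneBack a p ∘ₗ bd p + (-1 : ℤ) ^ (p + 1) • LinearMap.id := by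
    ext1 x
    ext1
    simp only [LinearMap.comp_apply, LinearMap.add_apply, LinearMap.smul_apply,
      Finsupp.lsingle_apply, coneBack_single, bd_single, LinearMap.id_apply, map_sum, map_smul]
    rw [Fin.sum_univ_castSucc]
    congr 1
    · refine Finset.sum_congr rfl fun i _ => ?_
      rw [Fin.val_castSucc]
      congr 2
      funext j
      refine Fin.lastCases ?_ (fun j => ?_) j
      · simp [Fin.succAbove_of_le_castSucc, Fin.le_last]
      · simp [Fin.castSucc_succAbove_castSucc]
    · rw [Fin.val_last]
      congr 2
      funext j
      simp
  exact LinearMap.congr_fun this c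

theorem bd_bd : ∀ {p : ℕ} (c : TupleChain α (p + 2)), bd p (bd (p + 1) c) = 0 := by
  intro p
  induction p with
  | zero =>
    intro c
    have : bd 0 ∘ₗ bd (α := α) 1 = 0 := by
      ext1 x
      ext1
      simp only [LinearMap.comp_apply, Finsupp.lsingle_apply, LinearMap.zero_apply]
      rw [← Fin.cons_self_tail x, ← coneFront_single, bd_coneFront, map_sub, bd_coneFront_zero,
        sub_self]
    exact LinearMap.congr_fun this c
  | succ p ih =>
    intro c
    have : bd (p + 1) ∘ₗ bd (α := α) (p + 2) = 0 := by
      ext1 x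
      ext1
      simp only [LinearMap.comp_apply, Finsupp.lsingle_apply, LinearMap.zero_apply]
      rw [← Fin.cons_self_tail x, ← coneFront_single, bd_coneFront, map_sub, bd_coneFront,
        ih, map_zero, sub_zero, sub_self]
    exact LinearMap.congr_fun this c

/-- A linear map sends the chains supported in `s` into `N` once it does so for each tuple
of `s`. -/
theorem map_mem_of_mem_supported {X M : Type*} [AddCommGroup M] {s : Set X} {N : Submodule ℤ M}
    (F : (X →₀ ℤ) →ₗ[ℤ] M) (h : ∀ x ∈ s, F (Finsupp.single x 1) ∈ N) {c : X →₀ ℤ}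
    (hc : c ∈ Finsupp.supported ℤ ℤ s) : F c ∈ N := by
  rw [Finsupp.supported_eq_span_single] at hc
  have : Submodule.span ℤ ((fun x => Finsupp.single x (1 : ℤ)) '' s) ≤ N.comap F := by
    rw [Submodule.span_le]
    rintro _ ⟨x, hx, rfl⟩
    exact h x hx
  exact this hc

theorem bd_mem_supported {s : Set (Fin (p + 1) → α)} {t : Set (Fin p → α)}
    (h : ∀ x ∈ s, ∀ i : Fin (p + 1), x ∘ i.succAbove ∈ t) {c : TupleChain α (p + 1)}
    (hc : c ∈ Finsupp.supported ℤ ℤ s) : bd p c ∈ Finsupp.supported ℤ ℤ t := by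
  refine map_mem_of_mem_supported (bd p) (fun x hx => ?_) hc
  rw [bd_single]
  exact Submodule.sum_mem _ fun i _ =>
    Submodule.smul_mem _ _ (Finsupp.single_mem_supported ℤ 1 (h x hx i))

theorem mapDomain_mem_supported {X Y : Type*} {F : X → Y} {s : Set X} {t : Set Y}
    (h : ∀ x ∈ s, F x ∈ t) {c : X →₀ ℤ} (hc : c ∈ Finsupp.supported ℤ ℤ s) :
    Finsupp.lmapDomain ℤ ℤ F c ∈ Finsupp.supported ℤ ℤ t := by
  refine map_mem_of_mem_supported _ (fun x hx => ?_) hc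
  rw [Finsupp.lmapDomain_apply, Finsupp.mapDomain_single]
  exact Finsupp.single_mem_supported ℤ 1 (h x hx)

/-! ### Chain homotopies carried by cones -/

/-- The chain homotopy from the identity to a chain map `φ` that is built degree by degree by
coning off: on a tuple `x`, the chain `φ x - x - h (bd x)` is a cycle, and `h x` is the cone over
it with apex `a x`. -/
noncomputable def homotopy (φ : ∀ p, TupleChain α p →ₗ[ℤ] TupleChain α p)
    (a : ∀ p, (Fin (p + 1) → α) → α) : ∀ p, TupleChain α p →ₗ[ℤ] TupleChain α (p + 1)
  | 0 => 0
  | p + 1 => Finsupp.linearCombination ℤ fun x =>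
      coneFront (a p x) (p + 1) (φ (p + 1) (Finsupp.single x 1) - Finsupp.single x 1 -
        homotopy φ a p (bd p (Finsupp.single x 1)))

variable {φ : ∀ p, TupleChain α p →ₗ[ℤ] TupleChain α p} (a : ∀ p, (Fin (p + 1) → α) → α)

theorem homotopy_single (x : Fin (p + 1) → α) :
    homotopy φ a (p + 1) (Finsupp.single x 1) =
      coneFront (a p x) (p + 1) (φ (p + 1) (Finsupp.single x 1) - Finsupp.single x 1 -
        homotopy φ a p (bd p (Finsupp.single x 1))) := by
  simp [homotopy]

theorem bd_homotopy (h0 : φ 0 = LinearMap.id)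
    (hφ : ∀ p (c : TupleChain α (p + 1)), bd p (φ (p + 1) c) = φ p (bd p c)) :
    ∀ {p : ℕ} (c : TupleChain α (p + 1)),
      bd (p + 1) (homotopy φ a (p + 1) c) = φ (p + 1) c - c - homotopy φ a p (bd p c) := by
  intro p
  induction p with
  | zero =>
    intro c
    have : bd 1 ∘ₗ homotopy φ a 1 = φ 1 - LinearMap.id - homotopy φ a 0 ∘ₗ bd 0 := by
      ext1 x
      ext1
      simp only [LinearMap.comp_apply, Finsupp.lsingle_apply, LinearMap.sub_apply,
        LinearMap.id_apply]
      rw [homotopy_single, bd_coneFront, map_sub, map_sub, map_sub, hφ, h0,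
        LinearMap.id_apply, sub_self]
      simp [homotopy]
    exact LinearMap.congr_fun this c
  | succ p ih =>
    intro c
    have : bd (p + 2) ∘ₗ homotopy φ a (p + 2) =
        φ (p + 2) - LinearMap.id - homotopy φ a (p + 1) ∘ₗ bd (p + 1) := by
      ext1 x
      ext1
      simp only [LinearMap.comp_apply, Finsupp.lsingle_apply, LinearMap.sub_apply,
        LinearMap.id_apply]
      rw [homotopy_single, bd_coneFront, map_sub, map_sub, map_sub, hφ, ih, bd_bd,
        map_zero, sub_zero, sub_self, sub_zero]
    exact LinearMap.congr_fun this c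

/-- The homotopy stays in a carrier: here the `S U` are families of tuples indexed by an ordered
set, `u x` is the least index whose family contains `x`, and each `S (u x)` is a cone with apex
`a x`. -/
theorem homotopy_mem_supported {L : Type*} [Preorder L] {S : L → ∀ q, Set (Fin q → α)}
    {u : ∀ p, (Fin (p + 1) → α) → L}
    (hmono : ∀ U U' q, U ≤ U' → S U q ⊆ S U' q)
    (hu : ∀ U p, ∀ x ∈ S U (p + 1), u p x ≤ U)
    (hself : ∀ U p, ∀ x ∈ S U (p + 1), x ∈ S (u p x) (p + 1))
    (hface : ∀ U p, ∀ x ∈ S U (p + 1), ∀ i : Fin (p + 1), x ∘ i.succAbove ∈ S U p)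
    (hcone : ∀ U p, ∀ x ∈ S U (p + 1), ∀ y ∈ S (u p x) (p + 1),
      (Fin.cons (a p x) y : Fin (p + 2) → α) ∈ S (u p x) (p + 2))
    (hφ : ∀ U p, ∀ x ∈ S U p, φ p (Finsupp.single x 1) ∈ Finsupp.supported ℤ ℤ (S U p)) :
    ∀ {p : ℕ} {U : L} {c : TupleChain α p}, c ∈ Finsupp.supported ℤ ℤ (S U p) →
      homotopy φ a p c ∈ Finsupp.supported ℤ ℤ (S U (p + 1)) := by
  intro p
  induction p with
  | zero => intro U c _; exact Submodule.zero_mem _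
  | succ p ih =>
    intro U c hc
    refine map_mem_of_mem_supported _ (fun x hx => ?_) hc
    rw [homotopy_single]
    have hx' := hself U p x hx
    have hx1 := Finsupp.single_mem_supported ℤ (1 : ℤ) hx'
    refine Finsupp.supported_mono (hmono _ _ _ (hu U p x hx)) ?_
    refine mapDomain_mem_supported (hcone U p x hx) ?_
    exact Submodule.sub_mem _ (Submodule.sub_mem _ (hφ _ _ x hx') hx1)
      (ih (bd_mem_supported (hface _ p) hx1))

/-! ### Subdivision of tuples of vectors into flags of subspaces -/

section Subdivision

variable {K V : Type*} [Field K] [AddCommGroup V] [Module K V] {p : ℕ}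

/-- The span of the entries of a tuple of nonzero vectors. -/
def tupleSpan (K : Type*) {V : Type*} [Field K] [AddCommGroup V] [Module K V] {p : ℕ}
    (x : Fin p → {v : V // v ≠ 0}) : Submodule K V :=
  Submodule.span K (Set.range fun i => (x i : V))

theorem tupleSpan_le {x : Fin p → {v : V // v ≠ 0}} {U : Submodule K V} :
    tupleSpan K x ≤ U ↔ ∀ i, (x i : V) ∈ U := by
  rw [tupleSpan, Submodule.span_le, Set.range_subset_iff]
  rfl

theorem mem_tupleSpan (x : Fin p → {v : V // v ≠ 0}) (i : Fin p) : (x i : V) ∈ tupleSpan K x :=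
  tupleSpan_le.1 le_rfl i

theorem tupleSpan_ne_bot (x : Fin (p + 1) → {v : V // v ≠ 0}) : tupleSpan K x ≠ ⊥ := fun h =>
  (x 0).2 ((Submodule.mem_bot K).1 (h ▸ mem_tupleSpan x 0))

/-- The tuples of nonzero vectors of the subspace `U`. -/
def vectorsIn (U : Submodule K V) (p : ℕ) : Set (Fin p → {v : V // v ≠ 0}) :=
  {x | ∀ i, (x i : V) ∈ U}

/-- The tuples of pairwise comparable nonzero subspaces contained in the subspace `U`. -/
def flagsBelow (U : Submodule K V) (p : ℕ) : Set (Fin p → Submodule K V) :=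
  {y | (∀ i, y i ≠ ⊥) ∧ (∀ i, y i ≤ U) ∧ ∀ i j, y i ≤ y j ∨ y j ≤ y i}

theorem vectorsIn_mono {U U' : Submodule K V} (h : U ≤ U') (p : ℕ) :
    vectorsIn U p ⊆ vectorsIn U' p := fun _ hx i => h (hx i)

theorem flagsBelow_mono {U U' : Submodule K V} (h : U ≤ U') (p : ℕ) :
    flagsBelow U p ⊆ flagsBelow U' p := fun _ hy => ⟨hy.1, fun i => (hy.2.1 i).trans h, hy.2.2⟩

theorem vectorsIn_face {U : Submodule K V} {x : Fin (p + 1) → {v : V // v ≠ 0}}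
    (hx : x ∈ vectorsIn U (p + 1)) (i : Fin (p + 1)) : x ∘ i.succAbove ∈ vectorsIn U p :=
  fun j => hx (i.succAbove j)

theorem flagsBelow_face {U : Submodule K V} {y : Fin (p + 1) → Submodule K V}
    (hy : y ∈ flagsBelow U (p + 1)) (i : Fin (p + 1)) : y ∘ i.succAbove ∈ flagsBelow U p :=
  ⟨fun _ => hy.1 _, fun _ => hy.2.1 _, fun _ _ => hy.2.2 _ _⟩

theorem snoc_mem_flagsBelow {U : Submodule K V} (hU : U ≠ ⊥) {y : Fin p → Submodule K V}
    (hy : y ∈ flagsBelow U p) : (Fin.snoc y U : Fin (p + 1) → Submodule K V) ∈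
      flagsBelow U (p + 1) := by
  refine ⟨fun i => ?_, fun i => ?_, fun i j => ?_⟩
  · refine Fin.lastCases ?_ (fun i => ?_) i
    · simpa using hU
    · simpa using hy.1 i
  · refine Fin.lastCases ?_ (fun i => ?_) i
    · simp
    · simpa using hy.2.1 i
  · refine Fin.lastCases ?_ (fun i => ?_) i <;> refine Fin.lastCases ?_ (fun j => ?_) j
    · simp
    · simp [hy.2.1 j]
    · simp [hy.2.1 i]
    · simpa using hy.2.2 i j

theorem cons_mem_flagsBelow {U : Submodule K V} (hU : U ≠ ⊥) {y : Fin p → Submodule K V}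
    (hy : y ∈ flagsBelow U p) : (Fin.cons U y : Fin (p + 1) → Submodule K V) ∈
      flagsBelow U (p + 1) := by
  refine ⟨fun i => ?_, fun i => ?_, fun i j => ?_⟩
  · refine Fin.cases ?_ (fun i => ?_) i
    · simpa using hU
    · simpa using hy.1 i
  · refine Fin.cases ?_ (fun i => ?_) i
    · simp
    · simpa using hy.2.1 i
  · refine Fin.cases ?_ (fun i => ?_) i <;> refine Fin.cases ?_ (fun j => ?_) j
    · simp
    · simp [hy.2.1 j]
    · simp [hy.2.1 i]
    · simpa using hy.2.2 i j

/-- The barycentric subdivision of tuples of nonzero vectors, each face being replaced by the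
subspace it spans. It is defined by recursion on the number of vertices: the subdivision of a tuple
is, up to sign, the cone over the subdivision of its boundary with the span as last vertex. -/
noncomputable def subdivision (K V : Type*) [Field K] [AddCommGroup V] [Module K V] :
    ∀ p, TupleChain {v : V // v ≠ 0} p →ₗ[ℤ] TupleChain (Submodule K V) p
  -- The value of the constant function is irrelevant: there is only the empty tuple.
  | 0 => map (fun _ => ⊥) 0
  | p + 1 => Finsupp.linearCombination ℤ fun x =>
      (-1 : ℤ) ^ p • coneBack (tupleSpan K x) p (subdivision K V p (bd p (Finsupp.single x 1)))

theorem subdivision_single (x : Fin (p + 1) → {v : V // v ≠ 0}) :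
    subdivision K V (p + 1) (Finsupp.single x 1) =
      (-1 : ℤ) ^ p •
        coneBack (tupleSpan K x) p (subdivision K V p (bd p (Finsupp.single x 1))) := by
  simp [subdivision]

theorem bd_subdivision : ∀ {p : ℕ} (c : TupleChain {v : V // v ≠ 0} (p + 1)),
    bd p (subdivision K V (p + 1) c) = subdivision K V p (bd p c) := by
  intro p
  induction p with
  | zero =>
    intro c
    have : bd 0 ∘ₗ subdivision K V 1 = subdivision K V 0 ∘ₗ bd 0 := by
      ext1 x
      ext1
      simp only [LinearMap.comp_apply, Finsupp.lsingle_apply]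
      rw [subdivision_single, map_smul, bd_coneBack_zero, pow_zero, one_smul]
    exact LinearMap.congr_fun this c
  | succ p ih =>
    intro c
    have : bd (p + 1) ∘ₗ subdivision K V (p + 2) = subdivision K V (p + 1) ∘ₗ bd (p + 1) := by
      ext1 x
      ext1
      simp only [LinearMap.comp_apply, Finsupp.lsingle_apply]
      rw [subdivision_single, map_smul, bd_coneBack, ih, bd_bd, map_zero, map_zero, zero_add,
        smul_smul, ← mul_pow, neg_one_mul, neg_neg, one_pow, one_smul]
    exact LinearMap.congr_fun this c

theorem subdivision_mem_supported : ∀ {p : ℕ} {U : Submodule K V}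
    {c : TupleChain {v : V // v ≠ 0} p}, c ∈ Finsupp.supported ℤ ℤ (vectorsIn U p) →
      subdivision K V p c ∈ Finsupp.supported ℤ ℤ (flagsBelow U p) := by
  intro p
  induction p with
  | zero =>
    intro U c _
    have : flagsBelow U 0 = Set.univ := Set.eq_univ_of_forall fun y =>
      ⟨fun i => i.elim0, fun i => i.elim0, fun i => i.elim0⟩
    rw [this, Finsupp.supported_univ]
    trivial
  | succ p ih =>
    intro U c hc
    refine map_mem_of_mem_supported _ (fun x hx => ?_) hc
    rw [subdivision_single]
    refine Submodule.smul_mem _ _ ?_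
    refine mapDomain_mem_supported
      (fun y hy => flagsBelow_mono (tupleSpan_le.2 hx) _
        (snoc_mem_flagsBelow (tupleSpan_ne_bot x) hy))
      (ih (bd_mem_supported (fun x hx => vectorsIn_face hx)
        (Finsupp.single_mem_supported ℤ 1 (mem_tupleSpan x))))

/-! ### Comparison with the flags of subspaces -/

open Classical in
/-- A choice of a nonzero vector in each nonzero subspace. -/
noncomputable def chosenVector [Nontrivial V] (W : Submodule K V) : {v : V // v ≠ 0} :=
  if h : W ≠ ⊥ then ⟨(Submodule.exists_mem_ne_zero_of_ne_bot h).choose,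
    (Submodule.exists_mem_ne_zero_of_ne_bot h).choose_spec.2⟩
  else ⟨(exists_ne (0 : V)).choose, (exists_ne (0 : V)).choose_spec⟩

theorem chosenVector_mem [Nontrivial V] {W : Submodule K V} (h : W ≠ ⊥) :
    (chosenVector W : V) ∈ W := by
  rw [chosenVector, dif_pos h]
  exact (Submodule.exists_mem_ne_zero_of_ne_bot h).choose_spec.1

theorem map_chosenVector_mem_supported [Nontrivial V] {U : Submodule K V}
    {c : TupleChain (Submodule K V) p} (hc : c ∈ Finsupp.supported ℤ ℤ (flagsBelow U p)) :
    map chosenVector p c ∈ Finsupp.supported ℤ ℤ (vectorsIn U p) :=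
  mapDomain_mem_supported (fun _ hy i => hy.2.1 i (chosenVector_mem (hy.1 i))) hc

/-- Subdividing a tuple of vectors and choosing vectors in the resulting subspaces is chain
homotopic to the identity, within the tuples of vectors of any given subspace. -/
theorem exists_homotopy_vectors [Nontrivial V] :
    ∃ h : ∀ p, TupleChain {v : V // v ≠ 0} p →ₗ[ℤ] TupleChain {v : V // v ≠ 0} (p + 1),
      (∀ p c, bd (p + 1) (h (p + 1) c) =
        map chosenVector (p + 1) (subdivision K V (p + 1) c) - c - h p (bd p c)) ∧
      ∀ p (U : Submodule K V), ∀ c ∈ Finsupp.supported ℤ ℤ (vectorsIn U p),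
        h p c ∈ Finsupp.supported ℤ ℤ (vectorsIn U (p + 1)) := by
  refine ⟨homotopy (fun p => map chosenVector p ∘ₗ subdivision K V p) fun p x => x 0,
    fun p c => bd_homotopy _ ?_ ?_ c, fun p U c hc => ?_⟩
  · ext1 x
    ext1
    simp [subdivision, map_single, Subsingleton.elim _ x]
  · intro p c
    simp only [LinearMap.comp_apply, bd_map, bd_subdivision]
  · refine homotopy_mem_supported (S := vectorsIn) (u := fun p x => tupleSpan K x) _
      (fun U U' q h => vectorsIn_mono h q) (fun U p x hx => tupleSpan_le.2 hx)
      (fun U p x _ => mem_tupleSpan x) (fun U p x hx => vectorsIn_face hx)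
      (fun U p x _ y hy i => ?_) (fun U p x hx => ?_) hc
    · refine Fin.cases ?_ (fun i => ?_) i
      · exact mem_tupleSpan x 0
      · exact hy i
    · exact map_chosenVector_mem_supported
        (subdivision_mem_supported (Finsupp.single_mem_supported ℤ 1 hx))

/-- Choosing vectors in the subspaces of a flag and subdividing is chain homotopic to the
identity, within the flags contained in any given subspace. -/
theorem exists_homotopy_flags [Nontrivial V] :
    ∃ h : ∀ p, TupleChain (Submodule K V) p →ₗ[ℤ] TupleChain (Submodule K V) (p + 1),
      (∀ p c, bd (p + 1) (h (p + 1) c) =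
        subdivision K V (p + 1) (map chosenVector (p + 1) c) - c - h p (bd p c)) ∧
      ∀ p (U : Submodule K V), ∀ c ∈ Finsupp.supported ℤ ℤ (flagsBelow U p),
        h p c ∈ Finsupp.supported ℤ ℤ (flagsBelow U (p + 1)) := by
  refine ⟨homotopy (fun p => subdivision K V p ∘ₗ map chosenVector p) fun p y => ⨆ i, y i,
    fun p c => bd_homotopy _ ?_ ?_ c, fun p U c hc => ?_⟩
  · ext1 x
    ext1
    simp [subdivision, map_single, Subsingleton.elim _ x]
  · intro p c
    simp only [LinearMap.comp_apply, bd_map, bd_subdivision]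
  · refine homotopy_mem_supported (S := flagsBelow) (u := fun p y => ⨆ i, y i) _
      (fun U U' q h => flagsBelow_mono h q) (fun U p y hy => iSup_le hy.2.1)
      (fun U p y hy => ⟨hy.1, le_iSup y, hy.2.2⟩) (fun U p y hy => flagsBelow_face hy)
      (fun U p x hx y hy => cons_mem_flagsBelow (fun h => hx.1 0 ?_) hy) (fun U p x hx => ?_) hc
    · exact le_bot_iff.1 (h ▸ le_iSup x 0)
    · exact subdivision_mem_supported
        (map_chosenVector_mem_supported (Finsupp.single_mem_supported ℤ 1 hx))

/-! ### The subdivision as a sum over permutations -/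

/-- The permutation of `Fin (p + 1)` with last value `i` and the other values listed by `e`. -/
def permSnoc (i : Fin (p + 1)) (e : Equiv.Perm (Fin p)) : Equiv.Perm (Fin (p + 1)) :=
  i.cycleRange.symm * Equiv.Perm.decomposeFin.symm (0, e) * finRotate (p + 1)

theorem permSnoc_last (i : Fin (p + 1)) (e : Equiv.Perm (Fin p)) :
    permSnoc i e (Fin.last p) = i := by
  simp [permSnoc, Fin.cycleRange_symm_zero]

theorem permSnoc_castSucc (i : Fin (p + 1)) (e : Equiv.Perm (Fin p)) (j : Fin p) :
    permSnoc i e j.castSucc = i.succAbove (e j) := by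
  simp [permSnoc, Fin.cycleRange_symm_succ]

theorem sign_permSnoc (i : Fin (p + 1)) (e : Equiv.Perm (Fin p)) :
    (Equiv.Perm.sign (permSnoc i e) : ℤ) =
      (-1) ^ p * ((-1) ^ (i : ℕ) * (Equiv.Perm.sign e : ℤ)) := by
  simp only [permSnoc, Equiv.Perm.sign_mul, Equiv.Perm.sign_symm, Fin.sign_cycleRange,
    Equiv.Perm.decomposeFin.symm_sign, sign_finRotate]
  simp
  ring

theorem permSnoc_bijective :
    Function.Bijective fun q : Fin (p + 1) × Equiv.Perm (Fin p) => permSnoc q.1 q.2 := by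
  rw [Fintype.bijective_iff_injective_and_card]
  refine ⟨?_, by simp [Fintype.card_perm, Nat.factorial_succ]⟩
  rintro ⟨i, e⟩ ⟨i', e'⟩ h
  have hi : i = i' := by
    simpa only [permSnoc_last] using Equiv.congr_fun h (Fin.last p)
  subst hi
  congr
  ext1 j
  have := Equiv.congr_fun h j.castSucc
  simp only [permSnoc_castSucc] at this
  exact Fin.succAbove_right_injective this

/-- Expansion of an alternating sum over permutations along the last value. -/
theorem sum_sign_smul_perm {M : Type*} [AddCommGroup M] (G : Equiv.Perm (Fin (p + 1)) → M) :
    ∑ σ, (Equiv.Perm.sign σ : ℤ) • G σ = (-1 : ℤ) ^ p • ∑ i : Fin (p + 1), (-1 : ℤ) ^ (i : ℕ) •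
      ∑ e : Equiv.Perm (Fin p), (Equiv.Perm.sign e : ℤ) • G (permSnoc i e) := by
  rw [← permSnoc_bijective.sum_comp, Fintype.sum_prod_type, Finset.smul_sum]
  refine Finset.sum_congr rfl fun i _ => ?_
  rw [Finset.smul_sum, Finset.smul_sum]
  refine Finset.sum_congr rfl fun e _ => ?_
  rw [sign_permSnoc, mul_smul, mul_smul]

/-- The span of the first `k` entries of a tuple. -/
def initialSpan (K : Type*) {V : Type*} [Field K] [AddCommGroup V] [Module K V] {p : ℕ}
    (x : Fin p → {v : V // v ≠ 0}) (k : ℕ) : Submodule K V :=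
  Submodule.span K ((fun i => (x i : V)) '' {i | (i : ℕ) < k})

theorem initialSpan_permSnoc (x : Fin (p + 1) → {v : V // v ≠ 0}) (i : Fin (p + 1))
    (e : Equiv.Perm (Fin p)) (k : ℕ) (hk : k ≤ p) :
    initialSpan K (x ∘ permSnoc i e) k = initialSpan K ((x ∘ i.succAbove) ∘ e) k := by
  unfold initialSpan
  congr 1
  ext w
  constructor
  · rintro ⟨j, hj, rfl⟩
    refine Fin.lastCases (fun hj => ?_) (fun j hj => ?_) j hj
    · simp only [Set.mem_ofPred_eq, Fin.val_last] at hj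
      omega
    · exact ⟨j, hj, by simp [permSnoc_castSucc]⟩
  · rintro ⟨j, hj, rfl⟩
    exact ⟨j.castSucc, hj, by simp [permSnoc_castSucc]⟩

theorem initialSpan_perm (x : Fin p → {v : V // v ≠ 0}) (σ : Equiv.Perm (Fin p)) :
    initialSpan K (x ∘ σ) p = tupleSpan K x := by
  unfold initialSpan tupleSpan
  have : {i : Fin p | (i : ℕ) < p} = Set.univ := Set.eq_univ_of_forall fun i => i.2
  rw [this, Set.image_univ]
  congr 1
  exact σ.surjective.range_comp fun i => (x i : V)

theorem subdivision_bd_single_of_eq_sum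
    (H : ∀ x : Fin p → {v : V // v ≠ 0}, subdivision K V p (Finsupp.single x 1) =
      ∑ σ : Equiv.Perm (Fin p), (Equiv.Perm.sign σ : ℤ) •
        Finsupp.single (fun k : Fin p => initialSpan K (x ∘ σ) (k + 1)) 1)
    (x : Fin (p + 1) → {v : V // v ≠ 0}) :
    subdivision K V p (bd p (Finsupp.single x 1)) = (-1 : ℤ) ^ p • ∑ σ : Equiv.Perm (Fin (p + 1)),
      (Equiv.Perm.sign σ : ℤ) •
        Finsupp.single (fun k : Fin p => initialSpan K (x ∘ σ) (k + 1)) 1 := by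
  rw [sum_sign_smul_perm, smul_smul, ← mul_pow, neg_one_mul, neg_neg, one_pow, one_smul, bd_single,
    map_sum]
  refine Finset.sum_congr rfl fun i _ => ?_
  rw [map_smul, H]
  congr 1
  refine Finset.sum_congr rfl fun e _ => ?_
  congr 2
  funext k
  exact (initialSpan_permSnoc x i e _ k.2).symm

theorem subdivision_single_eq_sum : ∀ {p : ℕ} (x : Fin p → {v : V // v ≠ 0}),
    subdivision K V p (Finsupp.single x 1) = ∑ σ : Equiv.Perm (Fin p),
      (Equiv.Perm.sign σ : ℤ) •
        Finsupp.single (fun k : Fin p => initialSpan K (x ∘ σ) (k + 1)) 1 := by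
  intro p
  induction p with
  | zero =>
    intro x
    simp only [subdivision, map_single, Finset.univ_unique, Finset.sum_singleton,
      Equiv.Perm.default_eq, Equiv.Perm.sign_one, Units.val_one, one_smul]
    congr 1
    exact Subsingleton.elim _ _
  | succ p ih =>
    intro x
    rw [subdivision_single, subdivision_bd_single_of_eq_sum ih, map_smul, smul_smul, ← mul_pow,
      neg_one_mul, neg_neg, one_pow, one_smul, map_sum]
    refine Finset.sum_congr rfl fun σ _ => ?_
    rw [map_smul, coneBack_single]
    congr 2
    funext k
    refine Fin.lastCases ?_ (fun k => ?_) k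
    · simp [initialSpan_perm]
    · simp

theorem subdivision_bd_single (x : Fin (p + 1) → {v : V // v ≠ 0}) :
    subdivision K V p (bd p (Finsupp.single x 1)) = (-1 : ℤ) ^ p • ∑ σ : Equiv.Perm (Fin (p + 1)),
      (Equiv.Perm.sign σ : ℤ) •
        Finsupp.single (fun k : Fin p => initialSpan K (x ∘ σ) (k + 1)) 1 :=
  subdivision_bd_single_of_eq_sum subdivision_single_eq_sum x

end Subdivision
end TupleChain

/-! ### Chains of the Tits building as chains of tuples of subspaces -/

section Symbols

open AbstractSimplicialComplex TupleChain

variable {K : Type u} {V : Type v} [Field K] [AddCommGroup V] [Module K V] {m p : ℕ}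

/-- The inclusion of the chains of the Tits building in the chains of tuples of subspaces. -/
noncomputable def flagEmb (K : Type u) (V : Type v) [Field K] [AddCommGroup V] [Module K V]
    (p : ℕ) : (titsBuilding K V).Chains p →ₗ[ℤ] TupleChain (Submodule K V) (p + 1) :=
  Finsupp.lmapDomain ℤ ℤ fun x i => (x.1 i).1

theorem flagEmb_single (x : (titsBuilding K V).OrderedSimplex p) :
    flagEmb K V p (Finsupp.single x 1) = Finsupp.single (fun i => (x.1 i).1) 1 := by
  simp [flagEmb, Finsupp.mapDomain_single]

theorem flagEmb_injective : Function.Injective (flagEmb K V p) :=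
  Finsupp.mapDomain_injective fun _ _ h =>
    Subtype.ext (funext fun i => Subtype.ext (congrFun h i))

theorem bd_flagEmb (c : (titsBuilding K V).Chains (p + 1)) :
    bd (p + 1) (flagEmb K V (p + 1) c) = flagEmb K V p ((titsBuilding K V).boundary p c) := by
  have : bd (p + 1) ∘ₗ flagEmb K V (p + 1) = flagEmb K V p ∘ₗ (titsBuilding K V).boundary p := by
    ext1 x
    ext1
    simp only [LinearMap.comp_apply, Finsupp.lsingle_apply, flagEmb_single, bd_single, boundary,
      Finsupp.linearCombination_single, one_smul, map_sum, map_smul]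
    rfl
  exact LinearMap.congr_fun this c

/-- On vertices, the boundary of tuple chains is the augmentation. -/
theorem bd_flagEmb_zero (c : (titsBuilding K V).Chains 0) :
    bd 0 (flagEmb K V 0 c) =
      (titsBuilding K V).chainAugmentation c • Finsupp.single Fin.elim0 1 := by
  have : bd 0 ∘ₗ flagEmb K V 0 =
      (titsBuilding K V).chainAugmentation.smulRight (Finsupp.single Fin.elim0 1) := by
    ext1 x
    ext1
    simp only [LinearMap.comp_apply, Finsupp.lsingle_apply, flagEmb_single, bd_single,
      LinearMap.smulRight_apply, chainAugmentation, Finsupp.linearCombination_single, one_smul]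
    rw [Fin.sum_univ_one, Fin.val_zero, pow_zero, one_smul]
    congr 1
    exact Subsingleton.elim _ _
  exact LinearMap.congr_fun this c

/-- The simplices of the Tits building are the tuples of `flagsBelow U` for a proper subspace `U`,
here taken to be the largest member of the flag. -/
theorem range_flagSimplex : (Set.range fun (x : (titsBuilding K V).OrderedSimplex p)
    (i : Fin (p + 1)) => (x.1 i).1) = ⋃ U ∈ {U : Submodule K V | U ≠ ⊤}, flagsBelow U (p + 1) := by
  classical
  ext y
  simp only [Set.mem_range, Set.mem_iUnion, exists_prop]
  constructor
  · rintro ⟨x, rfl⟩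
    obtain ⟨s, hs, hsx⟩ := x.2
    have hch : IsChain (· ≤ ·) (Set.range x.1) := hsx ▸ hs.2
    have hcmp : ∀ i j, x.1 i ≤ x.1 j ∨ x.1 j ≤ x.1 i := fun i j =>
      hch.total (Set.mem_range_self i) (Set.mem_range_self j)
    have hdir : Directed (· ≤ ·) x.1 := fun i j =>
      (hcmp i j).elim (fun h => ⟨j, h, le_rfl⟩) fun h => ⟨i, le_rfl, h⟩
    obtain ⟨k, hk⟩ := hdir.finite_le id
    exact ⟨(x.1 k).1, (x.1 k).2.2, fun i => (x.1 i).2.1, hk, hcmp⟩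
  · rintro ⟨U, hU, hy⟩
    refine ⟨⟨fun i => ⟨y i, hy.1 i, fun h => hU (top_le_iff.1 (h ▸ hy.2.1 i))⟩,
      Finset.univ.image fun i => ⟨y i, hy.1 i, fun h => hU (top_le_iff.1 (h ▸ hy.2.1 i))⟩,
      ⟨Finset.univ_nonempty.image _, ?_⟩, by simp⟩, rfl⟩
    rw [Finset.coe_image, Finset.coe_univ, Set.image_univ]
    rintro _ ⟨i, rfl⟩ _ ⟨j, rfl⟩ _
    exact hy.2.2 i j

theorem range_flagEmb : LinearMap.range (flagEmb K V p) =
    Finsupp.supported ℤ ℤ (⋃ U ∈ {U : Submodule K V | U ≠ ⊤}, flagsBelow U (p + 1)) := by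
  rw [← range_flagSimplex, ← Set.image_univ, ← Finsupp.lmapDomain_supported,
    Finsupp.supported_univ, Submodule.map_top]
  rfl

theorem mem_range_flagEmb {U : Submodule K V} (hU : U ≠ ⊤)
    {c : TupleChain (Submodule K V) (p + 1)}
    (hc : c ∈ Finsupp.supported ℤ ℤ (flagsBelow U (p + 1))) :
    c ∈ LinearMap.range (flagEmb K V p) := by
  rw [range_flagEmb]
  exact Finsupp.supported_mono (Set.subset_biUnion_of_mem (u := fun U => flagsBelow U (p + 1)) hU)
    hc

/-- A linear map on chains of tuples of subspaces maps the chains of the Tits building into `N`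
once it does so for the flags contained in each proper subspace. -/
theorem map_flagEmb_mem {M : Type*} [AddCommGroup M] {N : Submodule ℤ M}
    (F : TupleChain (Submodule K V) (p + 1) →ₗ[ℤ] M)
    (h : ∀ U : Submodule K V, U ≠ ⊤ →
      ∀ c ∈ Finsupp.supported ℤ ℤ (flagsBelow U (p + 1)), F c ∈ N)
    (c : (titsBuilding K V).Chains p) : F (flagEmb K V p c) ∈ N := by
  have hc : flagEmb K V p c ∈ LinearMap.range (flagEmb K V p) := ⟨c, rfl⟩
  rw [range_flagEmb] at hc
  refine map_mem_of_mem_supported F (fun y hy => ?_) hc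
  obtain ⟨U, hU, hy⟩ := Set.mem_iUnion₂.1 hy
  exact h U hU _ (Finsupp.single_mem_supported ℤ 1 hy)

/-! ### Universal modular symbols as subdivided boundaries -/

/-- The universal modular symbols, as cycles of the Tits building, extended linearly. -/
noncomputable def symbolCycle (hn : Module.finrank K V = m + 2) :
    FreeAbelianGroup (Fin (m + 2) → {v : V // v ≠ 0}) →+ (titsBuilding K V).cycles m :=
  FreeAbelianGroup.lift fun Q => ⟨(phi hn Q).mapChains m (fundamentalChain m),
    (phi hn Q).mapChains_mem_cycles m _ (fundamentalChain_mem_cycles m)⟩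

/-- The universal modular symbols in the homology of the Tits building, extended linearly. -/
noncomputable def symbolHom (hn : Module.finrank K V = m + 2) :
    FreeAbelianGroup (Fin (m + 2) → {v : V // v ≠ 0}) →+ (titsBuilding K V).Homology m :=
  FreeAbelianGroup.lift (symbolClass hn)

theorem symbolHom_eq_mkQ (hn : Module.finrank K V = m + 2)
    (x : FreeAbelianGroup (Fin (m + 2) → {v : V // v ≠ 0})) :
    symbolHom hn x = ((titsBuilding K V).boundaries m).mkQ (symbolCycle hn x) := by
  have : symbolHom hn = ((titsBuilding K V).boundaries m).mkQ.toAddMonoidHom.comp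
      (symbolCycle hn) := by
    ext Q
    simp only [symbolHom, FreeAbelianGroup.lift_apply_of, AddMonoidHom.comp_apply, symbolCycle]
    rfl
  exact DFunLike.congr_fun this x

theorem spanFace_permFace (hn : Module.finrank K V = m + 2) (Q : Fin (m + 2) → {v : V // v ≠ 0})
    (σ : Equiv.Perm (Fin (m + 2))) (k : Fin (m + 1)) :
    (spanFace hn Q (permFace σ k)).1 = initialSpan K (Q ∘ σ) (k + 1) := by
  simp only [spanFace, permFace, initialSpan]
  congr 1
  ext w
  simp only [Set.mem_image, Finset.coe_map, Finset.coe_Iic, Set.mem_Iic, Equiv.coe_toEmbedding,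
    exists_exists_and_eq_and, Set.mem_ofPred_eq, Function.comp_apply, Fin.le_def, Fin.val_castSucc,
    Nat.lt_succ_iff]

/-- The universal modular symbol of a sequence is the subdivision of its boundary. -/
theorem flagEmb_symbolCycle (hn : Module.finrank K V = m + 2)
    (x : FreeAbelianGroup (Fin (m + 2) → {v : V // v ≠ 0})) :
    flagEmb K V m (symbolCycle hn x).1 =
      subdivision K V (m + 1) (bd (m + 1) (FreeAbelianGroup.toFinsupp x)) := by
  have : (((flagEmb K V m) ∘ₗ ((titsBuilding K V).cycles m).subtype).toAddMonoidHom.comp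
      (symbolCycle hn)) = (subdivision K V (m + 1) ∘ₗ bd (m + 1)).toAddMonoidHom.comp
        FreeAbelianGroup.toFinsupp := by
    ext1 Q
    simp only [AddMonoidHom.comp_apply, symbolCycle, FreeAbelianGroup.lift_apply_of,
      FreeAbelianGroup.toFinsupp_of, LinearMap.toAddMonoidHom_coe, LinearMap.comp_apply,
      Submodule.subtype_apply]
    rw [subdivision_bd_single, fundamentalChain, map_smul, map_smul, map_sum, map_sum]
    congr 1
    refine Finset.sum_congr rfl fun σ _ => ?_
    rw [map_smul, map_smul, SimplicialMap.mapChains, Finsupp.lmapDomain_apply,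
      Finsupp.mapDomain_single, flagEmb_single]
    congr 2
    funext k
    exact spanFace_permFace hn Q σ k
  exact DFunLike.congr_fun this x

/-- Vanishing of a combination of symbols, as a statement about chains of tuples of subspaces. -/
theorem symbolHom_eq_zero_iff (hn : Module.finrank K V = m + 2)
    (x : FreeAbelianGroup (Fin (m + 2) → {v : V // v ≠ 0})) :
    symbolHom hn x = 0 ↔ ∃ b, bd (m + 1) (flagEmb K V (m + 1) b) =
      subdivision K V (m + 1) (bd (m + 1) (FreeAbelianGroup.toFinsupp x)) := by
  rw [symbolHom_eq_mkQ, ← flagEmb_symbolCycle hn, Submodule.mkQ_apply,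
    Submodule.Quotient.mk_eq_zero]
  simp only [bd_flagEmb, flagEmb_injective.eq_iff]
  rfl

/-! ### The relations hold -/

theorem subdivision_bd_single_comp_perm (x : Fin (p + 1) → {v : V // v ≠ 0})
    (τ : Equiv.Perm (Fin (p + 1))) :
    subdivision K V p (bd p (Finsupp.single (x ∘ τ) 1)) =
      (Equiv.Perm.sign τ : ℤ) • subdivision K V p (bd p (Finsupp.single x 1)) := by
  rw [subdivision_bd_single, subdivision_bd_single, smul_comm]
  congr 1
  symm
  rw [Finset.smul_sum, ← Equiv.sum_comp (Equiv.mulLeft τ)]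
  refine Finset.sum_congr rfl fun σ _ => ?_
  rw [Equiv.coe_mulLeft, smul_smul, Equiv.Perm.sign_mul, Units.val_mul, ← mul_assoc,
    Int.units_coe_mul_self, one_mul]
  rfl

theorem initialSpan_le_of_forall_mem_span {x y : Fin p → {v : V // v ≠ 0}}
    (h : ∀ i, (x i : V) ∈ Submodule.span K {(y i : V)}) (k : ℕ) :
    initialSpan K x k ≤ initialSpan K y k := by
  refine Submodule.span_le.2 ?_
  rintro _ ⟨i, hi, rfl⟩
  exact Submodule.span_mono (Set.singleton_subset_iff.2 (Set.mem_image_of_mem _ hi)) (h i)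

theorem det_ne_zero_iff_tupleSpan_eq_top {n : ℕ} (b : Module.Basis (Fin n) K V)
    (Q : Fin n → {v : V // v ≠ 0}) :
    b.det (fun i => (Q i : V)) ≠ 0 ↔ tupleSpan K Q = ⊤ := by
  rw [← isUnit_iff_ne_zero, ← Module.Basis.is_basis_iff_det]
  refine ⟨And.right, fun h => ⟨?_, h⟩⟩
  refine linearIndependent_of_top_le_span_of_card_eq_finrank h.ge ?_
  rw [Module.finrank_eq_card_basis b]

theorem toFinsupp_cocycle {n : ℕ} (P : Fin (n + 1) → {v : V // v ≠ 0}) :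
    FreeAbelianGroup.toFinsupp (∑ i : Fin (n + 1), (-1 : ℤ) ^ (i : ℕ) •
      FreeAbelianGroup.of (P ∘ i.succAbove)) = bd n (Finsupp.single P 1) := by
  simp only [map_sum, map_zsmul, FreeAbelianGroup.toFinsupp_of, bd_single]

theorem symbolHom_eq_zero_of_relation (hn : Module.finrank K V = m + 2)
    {x : FreeAbelianGroup (Fin (m + 2) → {v : V // v ≠ 0})}
    (hx : AshRudolphRelation K V (m + 2) x) : symbolHom hn x = 0 := by
  rw [symbolHom_eq_zero_iff]
  cases hx with
  | antisymmetry Q i j hij =>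
    refine ⟨0, ?_⟩
    simp only [map_zero, map_add, FreeAbelianGroup.toFinsupp_of, subdivision_bd_single_comp_perm,
      Equiv.Perm.sign_swap hij]
    simp
  | homogeneity Q Q' a ha h =>
    refine ⟨0, ?_⟩
    have h1 : ∀ i, (Q' i : V) ∈ Submodule.span K {(Q i : V)} := fun i => by
      rw [h]
      split_ifs
      · exact Submodule.smul_mem _ _ (Submodule.mem_span_singleton_self _)
      · exact Submodule.mem_span_singleton_self _
    have h2 : ∀ i, (Q i : V) ∈ Submodule.span K {(Q' i : V)} := fun i => by
      rw [h]
      split_ifs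
      · rw [Submodule.mem_span_singleton]
        exact ⟨a⁻¹, inv_smul_smul₀ ha _⟩
      · exact Submodule.mem_span_singleton_self _
    have h3 : ∀ σ : Equiv.Perm (Fin (m + 2)), ∀ k,
        initialSpan K (Q' ∘ σ) k = initialSpan K (Q ∘ σ) k := fun σ k =>
      le_antisymm (initialSpan_le_of_forall_mem_span (fun i => h1 (σ i)) k)
        (initialSpan_le_of_forall_mem_span (fun i => h2 (σ i)) k)
    simp only [map_zero, map_sub, FreeAbelianGroup.toFinsupp_of, subdivision_bd_single, h3,
      sub_self]
  | det Q b h =>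
    have hQ : tupleSpan K Q ≠ ⊤ := fun h' => (det_ne_zero_iff_tupleSpan_eq_top b Q).2 h' h
    obtain ⟨c, hc⟩ := mem_range_flagEmb hQ (subdivision_mem_supported
      (Finsupp.single_mem_supported ℤ (1 : ℤ) (mem_tupleSpan Q)))
    exact ⟨c, by rw [hc, bd_subdivision, FreeAbelianGroup.toFinsupp_of]⟩
  | cocycle P =>
    exact ⟨0, by rw [toFinsupp_cocycle, bd_bd, map_zero, map_zero, map_zero]⟩

/-! ### The relations suffice -/

theorem toFreeAbelianGroup_mem_of_supported [FiniteDimensional K V] {n : ℕ}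
    (hn : Module.finrank K V = n) {U : Submodule K V} (hU : U ≠ ⊤)
    {c : TupleChain {v : V // v ≠ 0} n} (hc : c ∈ Finsupp.supported ℤ ℤ (vectorsIn U n)) :
    Finsupp.toFreeAbelianGroup c ∈ ashRudolphSubgroup K V n := by
  refine map_mem_of_mem_supported (N := (ashRudolphSubgroup K V n).toIntSubmodule)
    (Finsupp.toFreeAbelianGroup (X := Fin n → {v : V // v ≠ 0})).toIntLinearMap
    (fun Q hQ => ?_) hc
  refine AddSubgroup.subset_closure ?_
  simp only [AddMonoidHom.coe_toIntLinearMap, Finsupp.toFreeAbelianGroup_single, one_smul]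
  refine AshRudolphRelation.det Q (Module.finBasisOfFinrankEq K V hn) ?_
  by_contra h
  rw [← ne_eq, det_ne_zero_iff_tupleSpan_eq_top] at h
  exact hU (top_le_iff.1 (h ▸ tupleSpan_le.2 hQ))

theorem toFreeAbelianGroup_bd_mem {n : ℕ} (c : TupleChain {v : V // v ≠ 0} (n + 1)) :
    Finsupp.toFreeAbelianGroup (bd n c) ∈ ashRudolphSubgroup K V n := by
  refine map_mem_of_mem_supported (s := Set.univ) (N := (ashRudolphSubgroup K V n).toIntSubmodule)
    ((Finsupp.toFreeAbelianGroup (X := Fin n → {v : V // v ≠ 0})).toIntLinearMap ∘ₗ bd n)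
    (fun P _ => ?_) (by rw [Finsupp.supported_univ]; trivial)
  refine AddSubgroup.subset_closure ?_
  simp only [LinearMap.comp_apply, AddMonoidHom.coe_toIntLinearMap]
  rw [← toFinsupp_cocycle, Finsupp.toFreeAbelianGroup_toFinsupp]
  exact AshRudolphRelation.cocycle P

/-- If the symbol of a chain `c` is zero, then `c` is, up to a boundary, a chain of tuples that do
not span `V`. Boundaries are generated by the cocycle relations, and the tuples that do not span
`V` are the determinant relations. -/
theorem mem_ashRudolphSubgroup_of_symbolHom_eq_zero [FiniteDimensional K V]
    (hn : Module.finrank K V = m + 2) {x : FreeAbelianGroup (Fin (m + 2) → {v : V // v ≠ 0})}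
    (hx : symbolHom hn x = 0) : x ∈ ashRudolphSubgroup K V (m + 2) := by
  have : Nontrivial V := Module.nontrivial_of_finrank_pos (R := K) (by omega)
  obtain ⟨b, hb⟩ := (symbolHom_eq_zero_iff hn x).1 hx
  obtain ⟨h, hh, hsupp⟩ := exists_homotopy_vectors (K := K) (V := V)
  set c : TupleChain {v : V // v ≠ 0} (m + 2) := FreeAbelianGroup.toFinsupp x
  -- The chain `w` lies in the tuples that span proper subspaces and has the same boundary as `c`.
  set w : TupleChain {v : V // v ≠ 0} (m + 2) :=
    map chosenVector (m + 2) (flagEmb K V (m + 1) b) - h (m + 1) (bd (m + 1) c) with hw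
  have hbd : bd (m + 1) w = bd (m + 1) c := by
    rw [hw, map_sub, bd_map, hb, hh, bd_bd, map_zero]
    abel
  have hw1 : Finsupp.toFreeAbelianGroup (map chosenVector (m + 2) (flagEmb K V (m + 1) b)) ∈
      ashRudolphSubgroup K V (m + 2) :=
    map_flagEmb_mem (N := (ashRudolphSubgroup K V (m + 2)).toIntSubmodule)
      ((Finsupp.toFreeAbelianGroup (X := Fin (m + 2) → {v : V // v ≠ 0})).toIntLinearMap ∘ₗ
        map chosenVector (m + 2))
      (fun U hU c hc => toFreeAbelianGroup_mem_of_supported hn hU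
        (map_chosenVector_mem_supported hc)) b
  have hw2 : Finsupp.toFreeAbelianGroup (h (m + 1) (bd (m + 1) c)) ∈
      ashRudolphSubgroup K V (m + 2) := by
    refine map_mem_of_mem_supported (s := Set.univ)
      (N := (ashRudolphSubgroup K V (m + 2)).toIntSubmodule)
      ((Finsupp.toFreeAbelianGroup (X := Fin (m + 2) → {v : V // v ≠ 0})).toIntLinearMap ∘ₗ
        h (m + 1) ∘ₗ bd (m + 1))
      (fun Q _ => ?_) (by rw [Finsupp.supported_univ]; trivial)
    simp only [LinearMap.comp_apply, bd_single, map_sum, map_smul]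
    refine Submodule.sum_mem _ fun i _ => Submodule.smul_mem _ _ ?_
    -- A face of `Q` has `m + 1 < dim V` vertices, hence spans a proper subspace.
    refine toFreeAbelianGroup_mem_of_supported hn (U := tupleSpan K (Q ∘ i.succAbove)) ?_
      (hsupp _ _ _ (Finsupp.single_mem_supported ℤ 1 (mem_tupleSpan _)))
    intro h
    have h1 := finrank_range_le_card (R := K) fun j => ((Q ∘ i.succAbove) j : V)
    rw [Set.finrank, ← tupleSpan, h, finrank_top, hn, Fintype.card_fin] at h1
    omega
  have v₀ : {v : V // v ≠ 0} := chosenVector (⊥ : Submodule K V)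
  have hcw : c = bd (m + 2) (coneFront v₀ (m + 2) (c - w)) + w := by
    rw [bd_coneFront, map_sub, hbd, sub_self, map_zero]
    abel
  have hx' : x = Finsupp.toFreeAbelianGroup c :=
    (Finsupp.toFreeAbelianGroup_toFinsupp x).symm
  rw [hx', hcw, map_add]
  refine AddSubgroup.add_mem _ (toFreeAbelianGroup_bd_mem _) ?_
  rw [hw, map_sub]
  exact AddSubgroup.sub_mem _ hw1 hw2

/-- The class of a reduced cycle `z` of flags is the symbol of the chain obtained by choosing a
vector in each subspace of `z` and coning off. -/
theorem exists_symbolHom_eq (hn : Module.finrank K V = m + 2)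
    (z : (titsBuilding K V).cycles m) (hz : bd m (flagEmb K V m z.1) = 0) :
    ∃ x, symbolHom hn x = ((titsBuilding K V).boundaries m).mkQ z := by
  have : Nontrivial V := Module.nontrivial_of_finrank_pos (R := K) (by omega)
  obtain ⟨h, hh, hsupp⟩ := exists_homotopy_flags (K := K) (V := V)
  have v₀ : {v : V // v ≠ 0} := chosenVector (⊥ : Submodule K V)
  refine ⟨Finsupp.toFreeAbelianGroup
    (coneFront v₀ (m + 1) (map chosenVector (m + 1) (flagEmb K V m z.1))), ?_⟩
  rw [symbolHom_eq_mkQ, Submodule.mkQ_apply, Submodule.mkQ_apply, Submodule.Quotient.eq]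
  obtain ⟨b, hb⟩ : h (m + 1) (flagEmb K V m z.1) ∈ LinearMap.range (flagEmb K V (m + 1)) :=
    map_flagEmb_mem (h (m + 1)) (fun U hU c hc => mem_range_flagEmb hU (hsupp _ _ _ hc)) z.1
  refine ⟨b, flagEmb_injective ?_⟩
  rw [← bd_flagEmb, hb, hh, hz, map_zero, sub_zero, Submodule.subtype_apply,
    AddSubgroupClass.coe_sub, map_sub, flagEmb_symbolCycle,
    FreeAbelianGroup.toFinsupp_toFreeAbelianGroup, bd_coneFront, bd_map, hz, map_zero, map_zero,
    sub_zero]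

theorem ker_symbolHom [FiniteDimensional K V] (hn : Module.finrank K V = m + 2)
    (x : FreeAbelianGroup (Fin (m + 2) → {v : V // v ≠ 0})) :
    symbolHom hn x = 0 ↔ x ∈ ashRudolphSubgroup K V (m + 2) := by
  refine ⟨mem_ashRudolphSubgroup_of_symbolHom_eq_zero hn, fun hx => ?_⟩
  have : ashRudolphSubgroup K V (m + 2) ≤ (symbolHom hn).ker :=
    (AddSubgroup.closure_le _).2 fun r hr => symbolHom_eq_zero_of_relation hn hr
  exact this hx

end Symbols

/-! ### The presentation -/

section Presentation

open TupleChain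

variable {K : Type u} {V : Type v} [Field K] [AddCommGroup V] [Module K V]

theorem nonempty_tuple_of_le_one {n : ℕ} (hn : Module.finrank K V = n) (hn1 : n ≤ 1) :
    Nonempty (Fin n → {v : V // v ≠ 0}) := by
  obtain rfl | rfl : n = 0 ∨ n = 1 := by omega
  · exact ⟨Fin.elim0⟩
  · have : Nontrivial V := Module.nontrivial_of_finrank_pos (R := K) (by omega)
    exact ⟨fun _ => chosenVector (⊥ : Submodule K V)⟩

theorem of_sub_of_mem_of_le_one {n : ℕ} (hn1 : n ≤ 1) (Q Q' : Fin n → {v : V // v ≠ 0}) :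
    FreeAbelianGroup.of Q - FreeAbelianGroup.of Q' ∈ ashRudolphSubgroup K V n := by
  obtain rfl | rfl : n = 0 ∨ n = 1 := by omega
  · rw [Subsingleton.elim Q Q', sub_self]
    exact AddSubgroup.zero_mem _
  · refine AddSubgroup.subset_closure ?_
    have h := AshRudolphRelation.cocycle (K := K) (n := 1) ![Q' 0, Q 0]
    rw [Fin.sum_univ_two] at h
    convert h using 1
    have h0 : ![Q' 0, Q 0] ∘ Fin.succAbove 0 = Q := by
      funext i
      rw [Subsingleton.elim i 0]
      rfl
    have h1 : ![Q' 0, Q 0] ∘ Fin.succAbove 1 = Q' := by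
      funext i
      rw [Subsingleton.elim i 0]
      rfl
    rw [h0, h1]
    simp [sub_eq_add_neg]

/-- In dimension at most `1`, the relations say exactly that all sequences are identified. -/
theorem lift_one_eq_zero_iff_of_le_one [FiniteDimensional K V] {n : ℕ}
    (hn : Module.finrank K V = n) (hn1 : n ≤ 1)
    (x : FreeAbelianGroup (Fin n → {v : V // v ≠ 0})) :
    FreeAbelianGroup.lift (fun _ => ULift.up.{v} (1 : ℤ)) x = 0 ↔ x ∈ ashRudolphSubgroup K V n := by
  constructor
  · intro hx
    obtain ⟨Q₀⟩ := nonempty_tuple_of_le_one hn hn1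
    have h : QuotientAddGroup.mk' (ashRudolphSubgroup K V n) =
        ((zmultiplesHom _ (QuotientAddGroup.mk' (ashRudolphSubgroup K V n)
          (FreeAbelianGroup.of Q₀))).comp AddEquiv.ulift.toAddMonoidHom).comp
            (FreeAbelianGroup.lift fun _ => ULift.up.{v} (1 : ℤ)) := by
      ext Q
      simp only [AddMonoidHom.comp_apply, FreeAbelianGroup.lift_apply_of, zmultiplesHom_apply]
      refine Eq.trans ?_ (one_smul ℤ _).symm
      rw [← sub_eq_zero, ← map_sub]
      exact (QuotientAddGroup.eq_zero_iff _).2 (of_sub_of_mem_of_le_one hn1 Q Q₀)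
    have h' := DFunLike.congr_fun h x
    rw [AddMonoidHom.comp_apply, hx, map_zero] at h'
    exact (QuotientAddGroup.eq_zero_iff _).1 h'
  · suffices h : ashRudolphSubgroup K V n ≤
        (FreeAbelianGroup.lift fun _ => ULift.up.{v} (1 : ℤ)).ker from fun hx => h hx
    refine (AddSubgroup.closure_le _).2 fun r hr => ?_
    rw [SetLike.mem_coe, AddMonoidHom.mem_ker]
    cases hr with
    | antisymmetry Q i j hij =>
      have := Fin.subsingleton_iff_le_one.2 hn1
      exact absurd (Subsingleton.elim i j) hij
    | homogeneity Q Q' a ha h => simp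
    | det Q b h =>
      have := Fin.subsingleton_iff_le_one.2 hn1
      refine absurd h ((det_ne_zero_iff_tupleSpan_eq_top b Q).2 ?_)
      have hli : LinearIndependent K fun i => (Q i : V) := by
        obtain rfl | rfl : n = 0 ∨ n = 1 := by omega
        · exact linearIndependent_empty_type
        · exact linearIndependent_unique_iff.2 (Q default).2
      refine hli.span_eq_top_of_card_eq_finrank' ?_
      rw [hn, Fintype.card_fin]
    | cocycle P =>
      obtain rfl | rfl : n = 0 ∨ n = 1 := by omega
      · have := Module.finrank_zero_iff.1 hn
        exact absurd (Subsingleton.elim _ _) (P 0).2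
      · simp [Fin.sum_univ_two]

/-- The inclusion of the reduced Steinberg module in dimension `2`. -/
noncomputable def steinbergTwoSubtype (K : Type u) (V : Type v) [Field K] [AddCommGroup V]
    [Module K V] : ReducedSteinberg K V 2 →+ (titsBuilding K V).Homology 0 :=
  (LinearMap.ker (titsBuilding K V).augmentation).subtype.toAddMonoidHom

theorem steinbergTwoSubtype_injective : Function.Injective (steinbergTwoSubtype K V) :=
  Subtype.val_injective

theorem steinbergTwoSubtype_lift (hn : Module.finrank K V = 2)
    (x : FreeAbelianGroup (Fin 2 → {v : V // v ≠ 0})) :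
    steinbergTwoSubtype K V (FreeAbelianGroup.lift (universalModularSymbol 2 hn) x) =
      symbolHom (m := 0) hn x := by
  have : (steinbergTwoSubtype K V).comp (FreeAbelianGroup.lift (universalModularSymbol 2 hn)) =
      symbolHom (m := 0) hn := by
    ext Q
    simp only [symbolHom, AddMonoidHom.comp_apply, FreeAbelianGroup.lift_apply_of]
    rfl
  exact DFunLike.congr_fun this x

/-- The presentation, in terms of the kernel and the image of the homomorphism from the free abelian
group. -/
theorem exists_equiv_of_ker_of_surjective {n : ℕ}
    (hn : Module.finrank K V = n)
    (hker : ∀ x, FreeAbelianGroup.lift (universalModularSymbol n hn) x = 0 ↔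
      x ∈ ashRudolphSubgroup K V n)
    (hsurj : Function.Surjective (FreeAbelianGroup.lift (universalModularSymbol n hn))) :
    ∃ e : (FreeAbelianGroup (Fin n → {v : V // v ≠ 0}) ⧸ ashRudolphSubgroup K V n) ≃+
        ReducedSteinberg K V n,
      ∀ Q : Fin n → {v : V // v ≠ 0},
        e (QuotientAddGroup.mk (FreeAbelianGroup.of Q)) = universalModularSymbol n hn Q := by
  have h : ashRudolphSubgroup K V n =
      (FreeAbelianGroup.lift (universalModularSymbol n hn)).ker := by
    ext x
    rw [AddMonoidHom.mem_ker, hker]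
  refine ⟨(QuotientAddGroup.quotientAddEquivOfEq h).trans
    (QuotientAddGroup.quotientKerEquivOfSurjective _ hsurj), fun Q => ?_⟩
  exact FreeAbelianGroup.lift_apply_of _ _

end Presentation

theorem corollary2 {K : Type u} {V : Type v} [Field K] [AddCommGroup V] [Module K V]
    [FiniteDimensional K V] (n : ℕ) (hn : Module.finrank K V = n) :
    ∃ e : (FreeAbelianGroup (Fin n → {v : V // v ≠ 0}) ⧸ ashRudolphSubgroup K V n) ≃+
        ReducedSteinberg K V n,
      ∀ Q : Fin n → {v : V // v ≠ 0},
        e (QuotientAddGroup.mk (FreeAbelianGroup.of Q)) = universalModularSymbol n hn Q := by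
  have small (h1 : n ≤ 1) : Function.Surjective (FreeAbelianGroup.lift
      fun _ : Fin n → {v : V // v ≠ 0} => ULift.up.{v} (1 : ℤ)) := fun ⟨k⟩ => by
    obtain ⟨Q⟩ := nonempty_tuple_of_le_one hn h1
    refine ⟨k • FreeAbelianGroup.of Q, ?_⟩
    rw [map_zsmul, FreeAbelianGroup.lift_apply_of]
    ext
    simp
  refine exists_equiv_of_ker_of_surjective hn ?_ ?_
  · match n, hn with
    | 0, hn => exact lift_one_eq_zero_iff_of_le_one hn zero_le_one
    | 1, hn => exact lift_one_eq_zero_iff_of_le_one hn le_rfl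
    | 2, hn =>
      intro x
      rw [← ker_symbolHom (m := 0) hn, ← steinbergTwoSubtype_lift,
        map_eq_zero_iff _ steinbergTwoSubtype_injective]
    | m + 3, hn => exact ker_symbolHom hn
  · match n, hn with
    | 0, hn => exact small zero_le_one
    | 1, hn => exact small le_rfl
    | 2, hn =>
      intro z
      obtain ⟨c, hc⟩ := Submodule.mkQ_surjective _ (steinbergTwoSubtype K V z)
      have hz : (titsBuilding K V).augmentation (steinbergTwoSubtype K V z) = 0 :=
        LinearMap.mem_ker.1 (Subtype.prop z)
      rw [← hc] at hz
      obtain ⟨x, hx⟩ := exists_symbolHom_eq (m := 0) hn c (by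
        rw [bd_flagEmb_zero]
        exact (congrArg (· • _) hz).trans (zero_smul _ _))
      exact ⟨x, steinbergTwoSubtype_injective ((steinbergTwoSubtype_lift hn x).trans
        (hx.trans hc))⟩
    | m + 3, hn =>
      intro z
      obtain ⟨c, hc⟩ := Submodule.mkQ_surjective _ (show (titsBuilding K V).Homology (m + 1) from z)
      obtain ⟨x, hx⟩ := exists_symbolHom_eq (m := m + 1) hn c (by
        have h0 : (titsBuilding K V).boundary m c.1 = 0 := c.2
        rw [bd_flagEmb, h0, map_zero])
      exact ⟨x, hx.trans hc⟩
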